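/- **Theorem.** Let $\Omega\subset\mathbb R^d$ ($d\ge 1$) be a domain (non-empty, open, connected) with smooth boundary and outward unit normal $\mathbf n$, let $g\in(-1,1)$, and let $\Xi,\sigma_s,\sigma_a^{P_2},\sigma_a^{P_1}$ be measurable coefficients on $\overline\Omega$ with values in $[\underline\alpha,\overline\alpha]$, where $0<\underline\alpha\le\overline\alpha<\infty$. Put $$D=\frac{1}{3(1-g)\sigma_s},\qquad \kappa=\frac{3}{7(1+g+g^2)},\qquad \kappa'=\frac{3}{1+g}\,\kappa .$$ Let $f\in L^2(\partial\Omega)$. All boundary value problems are understood in the weak sense in $H^1(\Omega)$, for functions with traces in $L^2(\partial\Omega)$ (and tested with such functions), and boundary values of solutions are traces. Let $\sigma_a^{P_2}$ and $\sigma_a^{P_1}$ be reconstructed from the same datum $H$, given in $\Omega$ and on $\partial\Omega$, with the simplified $P_2$ model and with the diffusion ($P_1$) model respectively. That is, there are solutions $(\phi_1,\phi_2)$ of $$\begin{aligned} -\nabla\cdot D\nabla\phi_1+\sigma_a^{P_2}\phi_1-\tfrac23\sigma_a^{P_2}\phi_2&=0 &&\text{in }\Omega,\\ -\nabla\cdot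 D\nabla\phi_2+\Big(\tfrac{5}{9\kappa'}\tfrac1D+\tfrac{4}{9\kappa}\sigma_a^{P_2}\Big)\phi_2-\tfrac{2}{3\kappa}\sigma_a^{P_2}\phi_1&=0 &&\text{in }\Omega,\\ \mathbf n\cdot D\nabla\phi_1+\tfrac12\phi_1-\tfrac18\phi_2&=\tfrac12 f &&\text{on }\partial\Omega,\\ \mathbf n\cdot D\nabla\phi_2+\tfrac{7}{24\kappa}\phi_2-\tfrac{1}{8\kappa}\phi_1&=-\tfrac{1}{8\kappa}f &&\text{on }\partial\Omega, \end{aligned}$$ and $\phi$ of $$-\nabla\cdot D\nabla\phi+\sigma_a^{P_1}\phi=0\ \text{ in }\Omega,\qquad \mathbf n\cdot D\nabla\phi+\tfrac12\phi=\tfrac12 f\ \text{ on }\partial\Omega,$$ such that $$H=\Xi\,\sigma_a^{P_2}\big(\phi_1-\tfrac23\phi_2\big)=\Xi\,\sigma_a^{P_1}\phi\qquad\text{a.e. in }\Omega\text{ and a.e. on }\partial\Omega .$$ Assume that the absorption coefficient is known on the boundary: $\sigma_a^{P_2}=\sigma_a^{P_1}=\sigma_a$ on $\partial\Omega$ for a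 given function $\sigma_a$. Then, at almost every point of $\Omega$ where $H\ne0$, $$\sigma_a^{P_2}-\sigma_a^{P_1}=\frac{H}{\Xi}\,\frac{\phi-(\phi_1-\frac23\phi_2)}{\phi\,(\phi_1-\frac23\phi_2)}=\frac23\,\frac{\Xi\,\sigma_a^{P_2}\sigma_a^{P_1}}{H}\,\phi_2 ,$$ and $\phi_2$ is the unique weak solution of the decoupled problem $$\begin{aligned} -\nabla\cdot D\nabla\phi_2+\frac{5}{9\kappa' D}\phi_2&=\frac{2}{3\kappa}\frac{H}{\Xi} &&\text{in }\Omega,\\ \mathbf n\cdot D\nabla\phi_2+\frac{5}{24\kappa}\phi_2&=\frac{1}{8\kappa}\Big(\frac{H}{\sigma_a\Xi}-f\Big)&&\text{on }\partial\Omega . \end{aligned}$$ -/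

import Mathlib

open MeasureTheory Set
open scoped ContDiff

noncomputable section

/-- Euclidean space `ℝᵈ`. -/
abbrev Eucl (d : ℕ) : Type := EuclideanSpace ℝ (Fin d)

/-- `ρ` is a smooth defining function of `Ω` near the boundary point `x`: near `x` the set `Ω` is
exactly `{ρ < 0}`, and `ρ` has non-zero gradient at `x`. -/
def IsLocalDefiningFunction {d : ℕ} (Ω : Set (Eucl d)) (x : Eucl d) (ρ : Eucl d → ℝ) : Prop :=
  ∃ U : Set (Eucl d), IsOpen U ∧ x ∈ U ∧ ContDiffOn ℝ ∞ ρ U ∧ ρ x = 0 ∧ gradient ρ x ≠ 0 ∧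
    ∀ y ∈ U, (y ∈ Ω ↔ ρ y < 0)

/-- A domain (non-empty, open, connected) with smooth boundary. -/
structure IsSmoothDomain {d : ℕ} (Ω : Set (Eucl d)) : Prop where
  isOpen : IsOpen Ω
  isConnected : IsConnected Ω
  smooth_boundary : ∀ x ∈ frontier Ω, ∃ ρ : Eucl d → ℝ, IsLocalDefiningFunction Ω x ρ

open Classical in
/-- The outward unit normal `∇ρ / |∇ρ|` at a smooth boundary point (it does not depend on the
defining function `ρ`); zero at other points. -/
def outwardNormal {d : ℕ} (Ω : Set (Eucl d)) (x : Eucl d) : Eucl d :=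
  if h : ∃ ρ : Eucl d → ℝ, IsLocalDefiningFunction Ω x ρ then
    ‖gradient h.choose x‖⁻¹ • gradient h.choose x
  else 0

/-- Lebesgue measure on `Ω`. -/
def bulk {d : ℕ} (Ω : Set (Eucl d)) : Measure (Eucl d) := volume.restrict Ω

/-- Surface measure on `∂Ω`: the `(d-1)`-dimensional Hausdorff measure, normalized so that it is
the usual surface area. -/
def surf {d : ℕ} (Ω : Set (Eucl d)) : Measure (Eucl d) :=
  (Measure.euclideanHausdorffMeasure (d - 1) : Measure (Eucl d)).restrict (frontier Ω)

/-- A function of the Sobolev space `H¹(Ω)` together with its weak gradient and its trace in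
`L²(∂Ω)`. Gradient and trace are pinned down, up to null sets, by the Gauss–Green formula: test
functions with support in `Ω` say that `grad` is the weak gradient, the others say that `trace` is
the boundary trace. (The integrability clause is automatic on a smooth domain.) -/
structure H1Function {d : ℕ} (Ω : Set (Eucl d)) where
  val : Eucl d → ℝ
  grad : Eucl d → Eucl d
  trace : Eucl d → ℝ
  memLp_val : MemLp val 2 (bulk Ω)
  memLp_grad : MemLp grad 2 (bulk Ω)
  memLp_trace : MemLp trace 2 (surf Ω)
  gauss_green : ∀ η : Eucl d → ℝ, ContDiff ℝ ∞ η → HasCompactSupport η → ∀ e : Eucl d,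
    Integrable (fun x => trace x * η x * inner ℝ (outwardNormal Ω x) e) (surf Ω) ∧
    ∫ x, val x * fderiv ℝ η x e ∂(bulk Ω) + ∫ x, inner ℝ (grad x) e * η x ∂(bulk Ω)
      = ∫ x, trace x * η x * inner ℝ (outwardNormal Ω x) e ∂(surf Ω)

/-- `u` is a weak (`H¹`) solution of
`-∇·(D ∇u) + R = 0` in `Ω`,  `n·D∇u + b = 0` on `∂Ω`,
where `R ∈ L²(Ω)` and `b ∈ L²(∂Ω)` collect all the lower order terms and the data. -/
def SolvesWeakly {d : ℕ} (Ω : Set (Eucl d)) (D : Eucl d → ℝ) (u : H1Function Ω)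
    (R b : Eucl d → ℝ) : Prop :=
  MemLp R 2 (bulk Ω) ∧ MemLp b 2 (surf Ω) ∧
  ∀ v : H1Function Ω,
    ∫ x, D x * inner ℝ (u.grad x) (v.grad x) ∂(bulk Ω) + ∫ x, R x * v.val x ∂(bulk Ω)
      + ∫ x, b x * v.trace x ∂(surf Ω) = 0

/-- A measurable coefficient on the closure of `Ω` with `α ≤ σ ≤ β`. -/
structure IsCoefficient {d : ℕ} (Ω : Set (Eucl d)) (α β : ℝ) (σ : Eucl d → ℝ) : Prop where
  aemeasurable : AEMeasurable σ (bulk Ω)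
  bounds : ∀ x ∈ closure Ω, α ≤ σ x ∧ σ x ≤ β

/-- `κ = 3 / (7 (1 + g + g²))`. -/
def kappa (g : ℝ) : ℝ := 3 / (7 * (1 + g + g ^ 2))

/-- `κ' = 3 κ / (1 + g)`. -/
def kappa' (g : ℝ) : ℝ := 3 / (1 + g) * kappa g

/-- The diffusion coefficient `D = 1 / (3 (1 - g) σ_s)`. -/
def diffCoeff {d : ℕ} (g : ℝ) (σs : Eucl d → ℝ) (x : Eucl d) : ℝ := 1 / (3 * (1 - g) * σs x)

/-- `(φ₁, φ₂)` is a weak solution of the simplified `P₂` system with absorption coefficient `σ`,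
scattering coefficient `σs`, anisotropy `g` and illumination `f`:

* `-∇·D∇φ₁ + σ φ₁ - (2/3) σ φ₂ = 0` in `Ω`,
* `-∇·D∇φ₂ + (5/(9κ') (1/D) + 4/(9κ) σ) φ₂ - 2/(3κ) σ φ₁ = 0` in `Ω`,
* `n·D∇φ₁ + (1/2) φ₁ - (1/8) φ₂ = (1/2) f` on `∂Ω`,
* `n·D∇φ₂ + 7/(24κ) φ₂ - 1/(8κ) φ₁ = - 1/(8κ) f` on `∂Ω`. -/
structure SolvesSP2 {d : ℕ} (Ω : Set (Eucl d)) (g : ℝ) (σs σ f : Eucl d → ℝ)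
    (φ₁ φ₂ : H1Function Ω) : Prop where
  eq₁ : SolvesWeakly Ω (diffCoeff g σs) φ₁
    (fun x => σ x * φ₁.val x - 2 / 3 * σ x * φ₂.val x)
    (fun x => 1 / 2 * φ₁.trace x - 1 / 8 * φ₂.trace x - 1 / 2 * f x)
  eq₂ : SolvesWeakly Ω (diffCoeff g σs) φ₂
    (fun x => (5 / (9 * kappa' g) * (1 / diffCoeff g σs x) + 4 / (9 * kappa g) * σ x) * φ₂.val x
      - 2 / (3 * kappa g) * σ x * φ₁.val x)
    (fun x => 7 / (24 * kappa g) * φ₂.trace x - 1 / (8 * kappa g) * φ₁.trace x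
      + 1 / (8 * kappa g) * f x)

/-- `φ` is a weak solution of the diffusion (`P₁`) model with absorption coefficient `σ`:
`-∇·D∇φ + σ φ = 0` in `Ω`, `n·D∇φ + (1/2) φ = (1/2) f` on `∂Ω`. -/
def SolvesDiffusion {d : ℕ} (Ω : Set (Eucl d)) (g : ℝ) (σs σ f : Eucl d → ℝ)
    (φ : H1Function Ω) : Prop :=
  SolvesWeakly Ω (diffCoeff g σs) φ
    (fun x => σ x * φ.val x) (fun x => 1 / 2 * φ.trace x - 1 / 2 * f x)

/-- The absorption coefficient `σ` is reconstructed from the datum `H`, given on the closure of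
`Ω`, with the simplified `P₂` model, `(φ₁, φ₂)` being the corresponding solution:
`H = Ξ σ (φ₁ - (2/3) φ₂)` in `Ω` and, in the sense of traces, on `∂Ω`. -/
structure ReconstructsSP2 {d : ℕ} (Ω : Set (Eucl d)) (g : ℝ) (σs Ξ f H σ : Eucl d → ℝ)
    (φ₁ φ₂ : H1Function Ω) : Prop where
  solves : SolvesSP2 Ω g σs σ f φ₁ φ₂
  datum : ∀ᵐ x ∂(bulk Ω), H x = Ξ x * σ x * (φ₁.val x - 2 / 3 * φ₂.val x)
  datum_boundary : ∀ᵐ x ∂(surf Ω), H x = Ξ x * σ x * (φ₁.trace x - 2 / 3 * φ₂.trace x)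

/-- The absorption coefficient `σ` is reconstructed from the datum `H`, given on the closure of
`Ω`, with the diffusion (`P₁`) model, `φ` being the corresponding solution:
`H = Ξ σ φ` in `Ω` and, in the sense of traces, on `∂Ω`. -/
structure ReconstructsDiffusion {d : ℕ} (Ω : Set (Eucl d)) (g : ℝ) (σs Ξ f H σ : Eucl d → ℝ)
    (φ : H1Function Ω) : Prop where
  solves : SolvesDiffusion Ω g σs σ f φ
  datum : ∀ᵐ x ∂(bulk Ω), H x = Ξ x * σ x * φ.val x
  datum_boundary : ∀ᵐ x ∂(surf Ω), H x = Ξ x * σ x * φ.trace x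

/-- `ψ` is a weak solution of the decoupled Robin problem

* `-∇·D∇ψ + 5/(9κ'D) ψ = 2/(3κ) H/Ξ` in `Ω`,
* `n·D∇ψ + 5/(24κ) ψ = 1/(8κ) (H/(σb Ξ) - f)` on `∂Ω`. -/
def SolvesDecoupled {d : ℕ} (Ω : Set (Eucl d)) (g : ℝ) (σs Ξ f H σb : Eucl d → ℝ)
    (ψ : H1Function Ω) : Prop :=
  SolvesWeakly Ω (diffCoeff g σs) ψ
    (fun x => 5 / (9 * kappa' g * diffCoeff g σs x) * ψ.val x - 2 / (3 * kappa g) * (H x / Ξ x))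
    (fun x => 5 / (24 * kappa g) * ψ.trace x
      - 1 / (8 * kappa g) * (H x / (σb x * Ξ x) - f x))

end

open Filter Topology


/-! Both models absorb the same energy: `σP2 (φ₁ - 2/3 φ₂) = H/Ξ = σP1 φ`. Subtracting the diffusion
equation from the first `P₂` equation therefore cancels the absorption terms. On `∂Ω` the absorption
coefficients agree, so the traces satisfy `φ₁ - 2/3 φ₂ = φ`, and `φ₁ - φ` solves a homogeneous Robin
problem with positive coefficient. Hence `φ₁ = φ`, and both formulas for `σP2 - σP1` are algebra.
Replacing `σP2 (φ₁ - 2/3 φ₂)` by `H/Ξ` in the second `P₂` equation decouples `φ₂`.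

Both uniqueness claims rest on `SolvesWeakly.val_ae_eq_zero`. The energy identity kills only the
gradient and the trace. In place of a Poincaré inequality, which would restrict `Ω`, the solution is
extended by zero to an `L²` function on `ℝᵈ` with zero weak gradient, and such a function vanishes.
-/

/-! ### Square integrable functions on `ℝᵈ` with zero weak gradient. -/

/-- The derivative in `t` is the pairing of `w` with the `e`-derivative of a translated test
function, which is zero by `h`. -/
theorem integral_comp_add_smul_eq {d : ℕ} {w : Eucl d → ℝ} (hw : LocallyIntegrable w volume)
    (h : ∀ η : Eucl d → ℝ, ContDiff ℝ ∞ η → HasCompactSupport η → ∀ e : Eucl d,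
      ∫ x, w x * fderiv ℝ η x e = 0)
    {η : Eucl d → ℝ} (hη : ContDiff ℝ ∞ η) (hc : HasCompactSupport η) (e : Eucl d) (t : ℝ) :
    ∫ x, w x * η (x + t • e) = ∫ x, w x * η x := by
  have hsm : ∀ s : ℝ, ContDiff ℝ ∞ fun x => η (x + s • e) := fun s => by fun_prop
  have hcs : ∀ s : ℝ, HasCompactSupport fun x => η (x + s • e) := fun s =>
    hc.comp_homeomorph (Homeomorph.addRight (s • e))
  have hint : ∀ {ζ : Eucl d → ℝ}, Continuous ζ → HasCompactSupport ζ →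
      Integrable (fun x => w x * ζ x) volume := fun hζ hζc => by
    simpa only [smul_eq_mul] using hw.integrable_smul_right_of_hasCompactSupport hζ hζc
  have hdc : Continuous fun x => fderiv ℝ η x e :=
    (hη.continuous_fderiv (by simp)).clm_apply continuous_const
  have hdcs : HasCompactSupport fun x => fderiv ℝ η x e :=
    (hc.fderiv ℝ).comp_left (g := fun L : Eucl d →L[ℝ] ℝ => L e) (by simp)
  obtain ⟨C, hC⟩ := hdc.bounded_above_of_compact_support hdcs
  obtain ⟨R, hR⟩ := hdcs.isBounded.exists_norm_le
  have hderiv : ∀ s : ℝ, HasDerivAt (fun s => ∫ x, w x * η (x + s • e)) 0 s := by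
    intro s
    have hd := (hasDerivAt_integral_of_dominated_loc_of_deriv_le (μ := volume) (𝕜 := ℝ)
      (F := fun s x => w x * η (x + s • e))
      (F' := fun s x => w x * fderiv ℝ η (x + s • e) e) (x₀ := s)
      -- For `|r - s| < 1` this ball contains every translate by `-r • e` of the support of the
      -- derivative, which lies within `R` of the origin.
      (bound := (Metric.closedBall (0 : Eucl d) (R + (|s| + 1) * ‖e‖)).indicator
        fun x => ‖w x‖ * C)
      (Metric.ball_mem_nhds s one_pos)
      (Eventually.of_forall fun r => (hint (hsm r).continuous (hcs r)).aestronglyMeasurable)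
      (hint (hsm s).continuous (hcs s)) ?_ ?_ ?_ ?_).2
    · have h0 := h _ (hsm s) (hcs s) e
      simp only [fderiv_comp_add_right] at h0
      rwa [h0] at hd
    · exact (hw.aestronglyMeasurable.mul
        (hdc.comp (continuous_id.add continuous_const)).aestronglyMeasurable)
    · refine Eventually.of_forall fun x r hr => ?_
      by_cases hx : x ∈ Metric.closedBall (0 : Eucl d) (R + (|s| + 1) * ‖e‖)
      · rw [indicator_of_mem hx, norm_mul]
        exact mul_le_mul_of_nonneg_left (hC _) (norm_nonneg _)
      · have hout : x + r • e ∉ tsupport fun x => fderiv ℝ η x e := fun hmem => hx <| by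
          have h1 := hR _ hmem
          have h2 : ‖x‖ ≤ ‖x + r • e‖ + ‖r • e‖ := by
            simpa using norm_sub_le (x + r • e) (r • e)
          have h3 : |r| ≤ |s| + 1 := by
            have := abs_sub_abs_le_abs_sub r s
            rw [Metric.mem_ball, Real.dist_eq] at hr
            linarith
          rw [norm_smul, Real.norm_eq_abs] at h2
          rw [mem_closedBall_zero_iff]
          nlinarith [norm_nonneg e]
        have hz := image_eq_zero_of_notMem_tsupport hout
        simp [hx, hz]
    · rw [integrable_indicator_iff measurableSet_closedBall]
      exact (hw.integrableOn_isCompact (isCompact_closedBall _ _)).norm.mul_const C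
    · refine Eventually.of_forall fun x r _ => ?_
      have h1 : HasDerivAt (fun r : ℝ => x + r • e) e r := by
        simpa using ((hasDerivAt_id r).smul_const e).const_add x
      exact (((hη.differentiable (by simp)) _).hasFDerivAt.comp_hasDerivAt r h1).const_mul _
  have := is_const_of_deriv_eq_zero (fun s => (hderiv s).differentiableAt)
    (fun s => (hderiv s).deriv) t 0
  simpa using this

/-- The pairing of `w` with `η` is unchanged when `η` is translated to infinity, where the `L²` mass
of `w` seen by `η` tends to zero. -/
theorem ae_eq_zero_of_weak_gradient_eq_zero {d : ℕ} (hd : 0 < d) {w : Eucl d → ℝ}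
    (hw : MemLp w 2 volume)
    (h : ∀ η : Eucl d → ℝ, ContDiff ℝ ∞ η → HasCompactSupport η → ∀ e : Eucl d,
      ∫ x, w x * fderiv ℝ η x e = 0) : w =ᵐ[volume] 0 := by
  have hloc : LocallyIntegrable w volume := hw.locallyIntegrable one_le_two
  have hw2 : Integrable (fun x => w x ^ 2) volume := hw.integrable_sq
  refine ae_eq_zero_of_integral_contDiff_smul_eq_zero hloc fun η hη hc => ?_
  have hηc : Continuous η := hη.continuous
  obtain ⟨e, he⟩ : ∃ e : Eucl d, e ≠ 0 := by
    refine ⟨EuclideanSpace.single ⟨0, hd⟩ 1, fun h0 => ?_⟩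
    simpa using congrArg (fun v : Eucl d => v ⟨0, hd⟩) h0
  have hη2 : Integrable (fun x => η x ^ 2) volume :=
    (hηc.pow 2).integrable_of_hasCompactSupport (by
      simpa [pow_two] using hc.mul_left (f := η))
  -- Mass of `w ^ 2` on translates of the support escapes.
  have hlim : Tendsto (fun n : ℕ => ∫ x, w x ^ 2 * (tsupport η).indicator 1 (x + (n : ℝ) • e))
      atTop (𝓝 0) := by
    have : Tendsto (fun n : ℕ => ∫ x, w x ^ 2 * (tsupport η).indicator 1 (x + (n : ℝ) • e))
      atTop (𝓝 (∫ x : Eucl d, (0 : ℝ))) := by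
      refine tendsto_integral_of_dominated_convergence (fun x => w x ^ 2) (fun n => ?_) hw2
        (fun n => ?_) ?_
      · refine hw2.aestronglyMeasurable.mul (Measurable.aestronglyMeasurable ?_)
        exact (measurable_one.indicator (isClosed_tsupport η).measurableSet).comp (by fun_prop)
      · refine Eventually.of_forall fun x => ?_
        by_cases hx : x + (n : ℝ) • e ∈ tsupport η <;> simp [hx, sq_nonneg]
      · refine Eventually.of_forall fun x => ?_
        obtain ⟨R, hR⟩ := hc.isBounded.exists_norm_le
        have hev : ∀ᶠ n : ℕ in atTop, R + ‖x‖ < (n : ℝ) * ‖e‖ :=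
          (tendsto_natCast_atTop_atTop.atTop_mul_const (norm_pos_iff.2 he)).eventually_gt_atTop _
        refine tendsto_const_nhds.congr' (hev.mono fun n hn => ?_)
        have hx : x + (n : ℝ) • e ∉ tsupport η := fun hx => by
          have h1 := hR _ hx
          have h2 : ‖(n : ℝ) • e‖ ≤ ‖x + (n : ℝ) • e‖ + ‖x‖ := by
            simpa using norm_sub_le (x + (n : ℝ) • e) x
          rw [norm_smul, Real.norm_natCast] at h2
          linarith
        simp [hx]
    simpa using this
  -- Young's inequality `|ab| ≤ ε b² + ε⁻¹ a²` on the translated support; the second term disappears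
  -- as `n → ∞`.
  have key : ∀ ε > 0, |∫ x, w x * η x| ≤ ε * ∫ x, η x ^ 2 := by
    intro ε hε
    have hb : ∀ n : ℕ, |∫ x, w x * η x| ≤ ε * (∫ x, η x ^ 2) +
        ε⁻¹ * ∫ x, w x ^ 2 * (tsupport η).indicator 1 (x + (n : ℝ) • e) := by
      intro n
      rw [← integral_comp_add_smul_eq hloc h hη hc e n,
        ← integral_add_right_eq_self (fun x => η x ^ 2) ((n : ℝ) • e), ← integral_const_mul,
        ← integral_const_mul]
      have hi1 : Integrable (fun x => ε * η (x + (n : ℝ) • e) ^ 2) volume :=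
        (hη2.comp_add_right ((n : ℝ) • e)).const_mul ε
      have hi2 : Integrable (fun x => ε⁻¹ *
          (w x ^ 2 * (tsupport η).indicator 1 (x + (n : ℝ) • e))) volume := by
        refine (hw2.mono' (hw2.aestronglyMeasurable.mul (Measurable.aestronglyMeasurable
          ((measurable_one.indicator (isClosed_tsupport η).measurableSet).comp
            (by fun_prop)))) (Eventually.of_forall fun x => ?_)).const_mul _
        by_cases hx : x + (n : ℝ) • e ∈ tsupport η <;> simp [hx, sq_nonneg]
      rw [← integral_add hi1 hi2]
      rw [← Real.norm_eq_abs]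
      refine norm_integral_le_of_norm_le (hi1.add hi2) (Eventually.of_forall fun x => ?_)
      by_cases hx : x + (n : ℝ) • e ∈ tsupport η
      · simp only [indicator_of_mem hx, Pi.one_apply, mul_one, Real.norm_eq_abs]
        set a := w x
        set b := η (x + (n : ℝ) • e)
        rw [abs_mul]
        have h1 : ε * b ^ 2 + ε⁻¹ * a ^ 2 - 2 * (|a| * |b|) = ε⁻¹ * (ε * |b| - |a|) ^ 2 := by
          rw [← sq_abs a, ← sq_abs b]; field_simp; ring
        have h2 : 0 ≤ ε⁻¹ * (ε * |b| - |a|) ^ 2 := by positivity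
        have h3 : 0 ≤ |a| * |b| := by positivity
        linarith
      · simp [hx, image_eq_zero_of_notMem_tsupport hx]
    have := ge_of_tendsto' ((hlim.const_mul ε⁻¹).const_add (ε * ∫ x, η x ^ 2)) hb
    simpa using this
  have hle : |∫ x, w x * η x| ≤ 0 := by
    have hl : Tendsto (fun ε : ℝ => ε * ∫ x, η x ^ 2) (𝓝[>] 0) (𝓝 (0 * ∫ x, η x ^ 2)) :=
      (tendsto_id.mul_const _).mono_left nhdsWithin_le_nhds
    rw [zero_mul] at hl
    exact ge_of_tendsto hl (eventually_mem_nhdsWithin.mono fun ε hε => key ε hε)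
  have := abs_nonpos_iff.1 hle
  simpa [mul_comm] using this

/-! ### The space `H¹(Ω)`. -/

theorem MeasureTheory.MemLp.integrable_inner_of_two {X E : Type*} [MeasurableSpace X]
    {μ : Measure X} [NormedAddCommGroup E] [InnerProductSpace ℝ E] {u v : X → E}
    (hu : MemLp u 2 μ) (hv : MemLp v 2 μ) :
    Integrable (fun x => inner ℝ (u x) (v x)) μ :=
  (hu.norm.integrable_mul hv.norm).mono' (hu.1.inner hv.1)
    (Eventually.of_forall fun _ => norm_inner_le_norm _ _)

namespace H1Function

variable {d : ℕ} {Ω : Set (Eucl d)}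

theorem integrable_val_mul_fderiv (u : H1Function Ω) {η : Eucl d → ℝ} (hη : ContDiff ℝ ∞ η)
    (hc : HasCompactSupport η) (e : Eucl d) :
    Integrable (fun x => u.val x * fderiv ℝ η x e) (bulk Ω) := by
  have hdc : Continuous fun x => fderiv ℝ η x e :=
    (hη.continuous_fderiv (by simp)).clm_apply continuous_const
  have hdcs : HasCompactSupport fun x => fderiv ℝ η x e :=
    (hc.fderiv ℝ).comp_left (g := fun L : Eucl d →L[ℝ] ℝ => L e) (by simp)
  exact u.memLp_val.integrable_mul (q := 2)
    ((hdc.memLp_of_hasCompactSupport hdcs).restrict Ω)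

theorem integrable_inner_grad_mul (u : H1Function Ω) {η : Eucl d → ℝ} (hη : Continuous η)
    (hc : HasCompactSupport η) (e : Eucl d) :
    Integrable (fun x => inner ℝ (u.grad x) e * η x) (bulk Ω) :=
  (u.memLp_grad.inner_const e).integrable_mul (q := 2)
    ((hη.memLp_of_hasCompactSupport hc).restrict Ω)

/-- The difference of two `H¹` functions. -/
def sub (u v : H1Function Ω) : H1Function Ω where
  val x := u.val x - v.val x
  grad x := u.grad x - v.grad x
  trace x := u.trace x - v.trace x
  memLp_val := u.memLp_val.sub v.memLp_val
  memLp_grad := u.memLp_grad.sub v.memLp_grad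
  memLp_trace := u.memLp_trace.sub v.memLp_trace
  gauss_green η hη hc e := by
    obtain ⟨hu, hu'⟩ := u.gauss_green η hη hc e
    obtain ⟨hv, hv'⟩ := v.gauss_green η hη hc e
    simp only [sub_mul, inner_sub_left]
    refine ⟨hu.sub hv, ?_⟩
    rw [integral_sub (u.integrable_val_mul_fderiv hη hc e) (v.integrable_val_mul_fderiv hη hc e),
      integral_sub (u.integrable_inner_grad_mul hη.continuous hc e)
        (v.integrable_inner_grad_mul hη.continuous hc e), integral_sub hu hv, ← hu', ← hv']
    ring

/-- An `H¹` function with vanishing gradient and vanishing trace is zero: its extension by zero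
is square integrable on `ℝᵈ` and has vanishing weak gradient there. -/
theorem val_ae_eq_zero (hd : 0 < d) (hΩ : MeasurableSet Ω) (u : H1Function Ω)
    (hgrad : u.grad =ᵐ[bulk Ω] 0) (htrace : u.trace =ᵐ[surf Ω] 0) : u.val =ᵐ[bulk Ω] 0 := by
  have hext : Ω.indicator u.val =ᵐ[volume] 0 := by
    refine ae_eq_zero_of_weak_gradient_eq_zero hd
      ((memLp_indicator_iff_restrict hΩ).2 u.memLp_val) fun η hη hc e => ?_
    have h1 : ∫ x, inner ℝ (u.grad x) e * η x ∂(bulk Ω) = 0 :=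
      integral_eq_zero_of_ae (hgrad.mono fun x hx => by simp [hx])
    have h2 : ∫ x, u.trace x * η x * inner ℝ (outwardNormal Ω x) e ∂(surf Ω) = 0 :=
      integral_eq_zero_of_ae (htrace.mono fun x hx => by simp [hx])
    -- Test functions need not vanish on `∂Ω`: with zero trace, the extension by zero has no jump
    -- contribution there.
    have h3 := (u.gauss_green η hη hc e).2
    rw [h1, h2, add_zero, bulk, ← integral_indicator hΩ] at h3
    simpa only [indicator_mul_left] using h3
  filter_upwards [ae_restrict_of_ae hext, ae_restrict_mem hΩ] with x hx hxΩ
  simpa [hxΩ] using hx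

end H1Function

/-! ### Linearity and uniqueness for weak Robin problems. -/

namespace SolvesWeakly

variable {d : ℕ} {Ω : Set (Eucl d)} {D : Eucl d → ℝ}

theorem congr {u : H1Function Ω} {R R' b b' : Eucl d → ℝ} (h : SolvesWeakly Ω D u R b)
    (hR : R =ᵐ[bulk Ω] R') (hb : b =ᵐ[surf Ω] b') : SolvesWeakly Ω D u R' b' := by
  refine ⟨h.1.ae_eq hR, h.2.1.ae_eq hb, fun v => ?_⟩
  rw [← h.2.2 v]
  congr 1
  · congr 1
    exact integral_congr_ae (hR.symm.mono fun x hx => by simp only [hx])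
  · exact integral_congr_ae (hb.symm.mono fun x hx => by simp only [hx])

theorem integrable_energy (hD : MemLp D ⊤ (bulk Ω)) (u v : H1Function Ω) :
    Integrable (fun x => D x * inner ℝ (u.grad x) (v.grad x)) (bulk Ω) :=
  hD.integrable_mul (memLp_one_iff_integrable.2
    (u.memLp_grad.integrable_inner_of_two v.memLp_grad))

theorem sub (hD : MemLp D ⊤ (bulk Ω)) {u v : H1Function Ω} {R S b c : Eucl d → ℝ}
    (hu : SolvesWeakly Ω D u R b) (hv : SolvesWeakly Ω D v S c) :
    SolvesWeakly Ω D (u.sub v) (fun x => R x - S x) (fun x => b x - c x) := by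
  refine ⟨hu.1.sub hv.1, hu.2.1.sub hv.2.1, fun w => ?_⟩
  simp only [H1Function.sub, inner_sub_left, mul_sub, sub_mul]
  have hR : ∫ x, (R x * w.val x - S x * w.val x) ∂(bulk Ω) = _ :=
    integral_sub (hu.1.integrable_mul w.memLp_val) (hv.1.integrable_mul w.memLp_val)
  have hb : ∫ x, (b x * w.trace x - c x * w.trace x) ∂(surf Ω) = _ :=
    integral_sub (hu.2.1.integrable_mul w.memLp_trace) (hv.2.1.integrable_mul w.memLp_trace)
  rw [integral_sub (integrable_energy hD u w) (integrable_energy hD v w), hR, hb]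
  linear_combination hu.2.2 w - hv.2.2 w

/-- Energy argument: a solution of a homogeneous Robin problem vanishes. -/
theorem val_ae_eq_zero (hd : 0 < d) (hΩ : MeasurableSet Ω) (hD : MemLp D ⊤ (bulk Ω))
    (hDpos : ∀ᵐ x ∂(bulk Ω), 0 < D x) {q : Eucl d → ℝ} (hq : ∀ᵐ x ∂(bulk Ω), 0 ≤ q x)
    {c : ℝ} (hc : 0 < c) {u : H1Function Ω}
    (h : SolvesWeakly Ω D u (fun x => q x * u.val x) (fun x => c * u.trace x)) :
    u.val =ᵐ[bulk Ω] 0 := by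
  have hE : 0 ≤ᵐ[bulk Ω] fun x => D x * inner ℝ (u.grad x) (u.grad x) :=
    hDpos.mono fun x hx => mul_nonneg hx.le real_inner_self_nonneg
  have hR : 0 ≤ᵐ[bulk Ω] fun x => q x * u.val x * u.val x :=
    hq.mono fun x hx => by
      simpa only [Pi.zero_apply, mul_assoc] using mul_nonneg hx (mul_self_nonneg (u.val x))
  have hB : 0 ≤ᵐ[surf Ω] fun x => c * u.trace x * u.trace x :=
    Eventually.of_forall fun x => by
      simpa only [Pi.zero_apply, mul_assoc] using mul_nonneg hc.le (mul_self_nonneg (u.trace x))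
  -- Tested with `u` itself, the equation says that three nonnegative integrals sum to zero.
  have hsum := h.2.2 u
  have hE0 := integral_nonneg_of_ae hE
  have hR0 := integral_nonneg_of_ae hR
  have hB0 := integral_nonneg_of_ae hB
  have hgrad := (integral_eq_zero_iff_of_nonneg_ae hE (integrable_energy hD u u)).1 (by linarith)
  have htrace := (integral_eq_zero_iff_of_nonneg_ae hB
    (h.2.1.integrable_mul u.memLp_trace)).1 (by linarith)
  refine u.val_ae_eq_zero hd hΩ ?_ ?_
  · filter_upwards [hgrad, hDpos] with x hx hDx
    simpa [hDx.ne'] using hx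
  · filter_upwards [htrace] with x hx
    simpa [hc.ne'] using hx

end SolvesWeakly

/-! ### Positivity and bounds of the coefficients. -/

theorem kappa_pos (g : ℝ) : 0 < kappa g := by
  have : 0 < 1 + g + g ^ 2 := by nlinarith [sq_nonneg (2 * g + 1)]
  unfold kappa
  positivity

theorem kappa'_pos {g : ℝ} (hg : -1 < g) : 0 < kappa' g := by
  have : 0 < 1 + g := by linarith
  have := kappa_pos g
  unfold kappa'
  positivity

namespace IsCoefficient

variable {d : ℕ} {Ω : Set (Eucl d)} {α β g : ℝ} {σ : Eucl d → ℝ}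

theorem pos (h : IsCoefficient Ω α β σ) (hα : 0 < α) {x : Eucl d} (hx : x ∈ closure Ω) :
    0 < σ x :=
  hα.trans_le (h.bounds x hx).1

theorem diffCoeff_pos (h : IsCoefficient Ω α β σ) (hα : 0 < α) (hg : g < 1) {x : Eucl d}
    (hx : x ∈ closure Ω) : 0 < diffCoeff g σ x := by
  have := h.pos hα hx
  have : 0 < 1 - g := by linarith
  unfold diffCoeff
  positivity

theorem memLp_top_diffCoeff (h : IsCoefficient Ω α β σ) (hα : 0 < α) (hg : g < 1)
    (hΩ : MeasurableSet Ω) : MemLp (diffCoeff g σ) ⊤ (bulk Ω) := by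
  refine memLp_top_of_bound
    ((h.aemeasurable.const_mul (3 * (1 - g))).const_div 1).aestronglyMeasurable
    (1 / (3 * (1 - g) * α)) ?_
  filter_upwards [ae_restrict_mem hΩ] with x hx
  rw [Real.norm_of_nonneg (h.diffCoeff_pos hα hg (subset_closure hx)).le, diffCoeff]
  have : 0 < 1 - g := by linarith
  have := (h.bounds x (subset_closure hx)).1
  gcongr

end IsCoefficient

/-! ### Comparison of the two reconstructions. -/

theorem SolvesDecoupled.val_ae_eq {d : ℕ} (hd : 0 < d) {Ω : Set (Eucl d)}
    (hΩ : MeasurableSet Ω) {g : ℝ} (hg : -1 < g) (hg' : g < 1) {α β : ℝ} (hα : 0 < α)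
    {σs Ξ f H σb : Eucl d → ℝ} (hσs : IsCoefficient Ω α β σs) {ψ φ : H1Function Ω}
    (hψ : SolvesDecoupled Ω g σs Ξ f H σb ψ) (hφ : SolvesDecoupled Ω g σs Ξ f H σb φ) :
    ψ.val =ᵐ[bulk Ω] φ.val := by
  have hκ := kappa_pos g
  have hκ' := kappa'_pos hg
  have hD := hσs.memLp_top_diffCoeff hα hg' hΩ
  have hDpos : ∀ᵐ x ∂(bulk Ω), 0 < diffCoeff g σs x := by
    filter_upwards [ae_restrict_mem hΩ] with x hx
    exact hσs.diffCoeff_pos hα hg' (subset_closure hx)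
  have h := SolvesWeakly.sub hD hψ hφ
  have h0 := SolvesWeakly.val_ae_eq_zero hd hΩ hD hDpos
    (q := fun x => 5 / (9 * kappa' g * diffCoeff g σs x)) (c := 5 / (24 * kappa g))
    (hDpos.mono fun x hx => by positivity) (by positivity)
    (h.congr (Eventually.of_forall fun x => by simp only [H1Function.sub]; ring)
      (Eventually.of_forall fun x => by simp only [H1Function.sub]; ring))
  exact h0.mono fun x hx => sub_eq_zero.1 hx

theorem theorem4p5 {d : ℕ} (hd : 0 < d) (Ω : Set (Eucl d)) (hΩ : IsSmoothDomain Ω)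
    (g : ℝ) (hg : -1 < g) (hg' : g < 1)
    (α β : ℝ) (hα : 0 < α)
    (Ξ σs σP2 σP1 σb f H : Eucl d → ℝ)
    (hΞ : IsCoefficient Ω α β Ξ) (hσs : IsCoefficient Ω α β σs)
    (hσP2 : IsCoefficient Ω α β σP2) (hσP1 : IsCoefficient Ω α β σP1)
    -- the boundary values of the absorption coefficient are known
    (hbP2 : ∀ x ∈ frontier Ω, σP2 x = σb x) (hbP1 : ∀ x ∈ frontier Ω, σP1 x = σb x)
    (hf : MemLp f 2 (surf Ω))
    (φ₁ φ₂ φ : H1Function Ω)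
    (hP2 : ReconstructsSP2 Ω g σs Ξ f H σP2 φ₁ φ₂)
    (hP1 : ReconstructsDiffusion Ω g σs Ξ f H σP1 φ) :
    (∀ᵐ x ∂(bulk Ω), H x ≠ 0 →
      σP2 x - σP1 x = H x / Ξ x * ((φ.val x - (φ₁.val x - 2 / 3 * φ₂.val x)) /
          (φ.val x * (φ₁.val x - 2 / 3 * φ₂.val x))) ∧
      σP2 x - σP1 x = 2 / 3 * (Ξ x * σP2 x * σP1 x / H x) * φ₂.val x) ∧
    SolvesDecoupled Ω g σs Ξ f H σb φ₂ ∧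
    (∀ ψ : H1Function Ω, SolvesDecoupled Ω g σs Ξ f H σb ψ → ψ.val =ᵐ[bulk Ω] φ₂.val) := by
  have hΩm : MeasurableSet Ω := hΩ.isOpen.measurableSet
  have hbulk : ∀ᵐ x ∂(bulk Ω), x ∈ closure Ω :=
    (ae_restrict_mem hΩm).mono fun x hx => subset_closure hx
  have hsurf : ∀ᵐ x ∂(surf Ω), x ∈ frontier Ω := ae_restrict_mem isClosed_frontier.measurableSet
  have hD := hσs.memLp_top_diffCoeff hα hg' hΩm
  have hDpos : ∀ᵐ x ∂(bulk Ω), 0 < diffCoeff g σs x :=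
    hbulk.mono fun x hx => hσs.diffCoeff_pos hα hg' hx
  have hκ := kappa_pos g
  have hκ' := kappa'_pos hg
  -- The first moment of the `P₂` model is the solution of the diffusion model.
  have hφ : φ₁.val =ᵐ[bulk Ω] φ.val := by
    have h0 := SolvesWeakly.val_ae_eq_zero hd hΩm hD hDpos
      -- On `∂Ω`, `φ₂ = 3/2 (φ₁ - φ)`, so the Robin coefficient of `φ₁ - φ` is `1/2 - 1/8 · 3/2 =
      -- 5/16`.
      (q := fun _ => 0) (c := 5 / 16) (Eventually.of_forall fun _ => le_rfl) (by norm_num)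
      ((hP2.solves.eq₁.sub hD hP1.solves).congr
        (by
          filter_upwards [hP2.datum, hP1.datum, hbulk] with x h2 h1 hx
          have : Ξ x * (σP2 x * φ₁.val x - 2 / 3 * σP2 x * φ₂.val x - σP1 x * φ.val x) = 0 := by
            linear_combination h1 - h2
          simpa [(hΞ.pos hα hx).ne'] using this)
        (by
          filter_upwards [hP2.datum_boundary, hP1.datum_boundary, hsurf] with x h2 h1 hx
          have hx' := frontier_subset_closure hx
          have hne : Ξ x * σP1 x ≠ 0 := (mul_pos (hΞ.pos hα hx') (hσP1.pos hα hx')).ne'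
          rw [hbP2 x hx, ← hbP1 x hx] at h2
          have htr : φ₁.trace x - 2 / 3 * φ₂.trace x = φ.trace x :=
            mul_left_cancel₀ hne (h2.symm.trans h1)
          simp only [H1Function.sub]
          linear_combination (3 / 16 : ℝ) * htr))
    exact h0.mono fun x hx => sub_eq_zero.1 hx
  -- In `Ω` the datum absorbs all of `4/(9κ) σP2 φ₂`; on `∂Ω` it leaves `7/(24κ) - 1/(12κ) =
  -- 5/(24κ)` in front of `φ₂`.
  have hdec : SolvesDecoupled Ω g σs Ξ f H σb φ₂ := by
    refine hP2.solves.eq₂.congr ?_ ?_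
    · filter_upwards [hP2.datum, hbulk, hDpos] with x h2 hx hDx
      have hΞx := (hΞ.pos hα hx).ne'
      rw [h2]
      field_simp
      ring
    · filter_upwards [hP2.datum_boundary, hsurf] with x h2 hx
      have hx' := frontier_subset_closure hx
      have hΞx := (hΞ.pos hα hx').ne'
      have hσx := (hσP2.pos hα hx').ne'
      rw [h2, ← hbP2 x hx]
      field_simp
      ring
  refine ⟨?_, hdec, fun ψ hψ => hψ.val_ae_eq hd hΩm hg hg' hα hσs hdec⟩
  filter_upwards [hP2.datum, hP1.datum, hbulk, hφ] with x h2 h1 hx hφx hH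
  have hΞx := (hΞ.pos hα hx).ne'
  have hσ1 := (hσP1.pos hα hx).ne'
  have hσ2 := (hσP2.pos hα hx).ne'
  have hφ0 : φ.val x ≠ 0 := fun h => hH (by simp [h1, h])
  have hψ0 : φ₁.val x - 2 / 3 * φ₂.val x ≠ 0 := fun h => hH (by simp [h2, h])
  -- This is where `φ₁ = φ` enters: `φ₂` measures the gap between the two fluences.
  have hφ₂ : φ₂.val x = 3 / 2 * (φ.val x - (φ₁.val x - 2 / 3 * φ₂.val x)) := by
    rw [← hφx]; ring
  generalize φ₁.val x - 2 / 3 * φ₂.val x = p at h2 hψ0 hφ₂ ⊢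
  have e2 : σP2 x = H x / Ξ x / p := by rw [h2]; field_simp
  have e1 : σP1 x = H x / Ξ x / φ.val x := by rw [h1]; field_simp
  rw [hφ₂, e2, e1]
  constructor <;> field_simp
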